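/- For $z=(x_0,\omega_0)\in\mathbb{R}^2$ let $\phi_z(x)=2^{1/4}e^{2\pi i\omega_0 x}e^{-\pi(x-x_0)^2}$, $x\in\mathbb{R}$. A density matrix is a bounded operator $\rho\ge 0$ on $L^2(\mathbb{R})$ (complex-valued functions) with $\operatorname{Tr}\rho=1$. For a density matrix $\rho$ put $$u_\rho(z)=\langle\phi_z,\rho\,\phi_z\rangle\quad(z\in\mathbb{R}^2),\qquad T=\max_{z\in\mathbb{R}^2}u_\rho(z),\qquad \mu(t)=|\{z\in\mathbb{R}^2: u_\rho(z)>t\}|\quad(t>0),$$ where $|\cdot|$ is Lebesgue measure on $\mathbb{R}^2$. (The supremum of $u_\rho$ is attained for every density matrix $\rho$; this is part of the claim.) For every $t_0\in(0,1)$ there exist $T_0\in(t_0,1)$ and $C_0>0$, both depending only on $t_0$, such that for every density matrix $\rho$ on $L^2(\mathbb{R})$ with $T\ge T_0$, $$\mu(t)\le\bigl(1+C_0(1-T)\bigr)\log\frac{T}{t}\qquad\text{for all } t\in[t_0,T].$$ -/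

import Mathlib

open MeasureTheory

/-- The complex Hilbert space `L²(ℝ)`. -/
abbrev L2R : Type := Lp ℂ 2 (volume : Measure ℝ)

/-- The coherent state `φ_{(x₀,ω₀)}(x) = e^{2πiω₀x} φ(x - x₀)` with `φ(x) = 2^{1/4} e^{-πx²}`,
as a function; here `z = (x₀, ω₀)`. -/
noncomputable def coherentFun (z : ℝ × ℝ) (x : ℝ) : ℂ :=
  Complex.exp (((2 * Real.pi * z.2 * x : ℝ) : ℂ) * Complex.I) *
    (((2 : ℝ) ^ (1 / 4 : ℝ) * Real.exp (-Real.pi * (x - z.1) ^ 2) : ℝ) : ℂ)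

theorem memLp_coherentFun (z : ℝ × ℝ) : MemLp (coherentFun z) 2 (volume : Measure ℝ) := by
  have hc : Continuous (coherentFun z) := by
    unfold coherentFun
    fun_prop
  rw [memLp_two_iff_integrable_sq_norm hc.aestronglyMeasurable]
  have h := ((integrable_exp_neg_mul_sq (b := 2 * Real.pi) (by positivity)).comp_sub_right
    z.1).const_mul (((2 : ℝ) ^ (1 / 4 : ℝ)) ^ 2)
  refine h.congr (Filter.Eventually.of_forall fun x => ?_)
  have h1 : ‖coherentFun z x‖ = (2 : ℝ) ^ (1 / 4 : ℝ) * Real.exp (-Real.pi * (x - z.1) ^ 2) := by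
    unfold coherentFun
    rw [norm_mul, Complex.norm_exp_ofReal_mul_I, one_mul, Complex.norm_real, Real.norm_eq_abs,
      abs_of_nonneg (by positivity)]
  simp only [h1, mul_pow, ← Real.exp_nat_mul]
  congr 2
  push_cast
  ring

/-- The coherent state `φ_{(x₀,ω₀)}` as an element of `L²(ℝ)`. -/
noncomputable def coherentState (z : ℝ × ℝ) : L2R := (memLp_coherentFun z).toLp

/-- A density matrix on `L²(ℝ)`: a bounded operator `ρ ≥ 0` with `Tr ρ = 1`. The trace of a
nonnegative operator is `∑ ⟨e_i, ρ e_i⟩` for an orthonormal basis `(e_i)`; its value does not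
depend on the basis, so one basis is enough. -/
def IsDensityMatrix (ρ : L2R →L[ℂ] L2R) : Prop :=
  ρ.IsPositive ∧ ∃ (ι : Type) (e : HilbertBasis ι ℂ L2R),
    HasSum (fun i => inner ℂ (e i) (ρ (e i))) 1

/-- The Husimi function (covariant symbol) `u_ρ(z) = ⟨φ_z, ρ φ_z⟩`. It is real-valued for
`ρ ≥ 0`, so that taking the real part loses nothing. -/
noncomputable def husimi (ρ : L2R →L[ℂ] L2R) (z : ℝ × ℝ) : ℝ :=
  (inner ℂ (coherentState z) (ρ (coherentState z))).re

/-- `T`, the largest value of `u_ρ`, as a supremum. -/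
noncomputable def husimiMax (ρ : L2R →L[ℂ] L2R) : ℝ := ⨆ z, husimi ρ z

/-- The distribution function `μ(t) = |{u_ρ > t}|`, with respect to Lebesgue measure on `ℝ²`. -/
noncomputable def husimiDistr (ρ : L2R →L[ℂ] L2R) (t : ℝ) : ENNReal :=
  volume {z : ℝ × ℝ | t < husimi ρ z}

/-! Write `ρ = S²` with `S` symmetric: then `u_ρ(p) = ‖S φ_p‖²`, and trace one says that `S` has
Hilbert–Schmidt norm one. A maximum point `z` exists because `φ_p` tends weakly to zero at infinity,
which `S` turns into norm convergence. Rescaling `φ_{z+w}` by a factor of modulus `e^{π|w|²/2}`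
gives a vector `k(w)`, weakly entire in `w`, with `k(w) - φ_z ⟂ φ_z`. Hence `e^{π|w|²} u_ρ(z+w) = T
+ Re F(w) + ‖S(k(w) - φ_z)‖²` with `F` entire and `F(0) = 0`; maximality forces `F'(0) = 0`
(`deriv_firstOrderTerm_zero`). Trace one leaves only `1 - T` for directions orthogonal to `φ_z`
(`norm_map_sq_le_of_inner_eq_zero`), so on a fixed disc the last term is `O(1-T)|w|²`, whereas `F`
is only `O(√(1-T))`.

Taking logarithms puts `{u_ρ > t}`, recentred at `z`, inside a perturbed disc `π|w|² ≤ log(T/t) + Re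
F(w)/T + A|w|²` with `A = O(1-T)`. Since `Re F` has mean zero on circles, it affects the area bound
only through its square, of order `1 - T` (`volume_le_of_perturbed_disc`). The double zero of `F`
makes every error proportional to the squared radius of the unperturbed disc, hence to `log(T/t)`;
this keeps the bound multiplicative as `t` approaches `T`. -/

/-! ### Square roots and traces of positive operators -/

section PositiveOperators

variable {E : Type*} [NormedAddCommGroup E] [InnerProductSpace ℂ E]

/-- A positive operator is the square of a symmetric operator. -/
theorem ContinuousLinearMap.IsPositive.exists_symmetric_sqrt [CompleteSpace E] {ρ : E →L[ℂ] E}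
    (hρ : ρ.IsPositive) :
    ∃ S : E →L[ℂ] E, (∀ x y, inner ℂ (S x) y = inner ℂ x (S y)) ∧
      ∀ x y, inner ℂ x (ρ y) = inner ℂ (S x) (S y) := by
  have h0 : 0 ≤ ρ := (ContinuousLinearMap.nonneg_iff_isPositive ρ).2 hρ
  have hS : (CFC.sqrt ρ).IsPositive :=
    (ContinuousLinearMap.nonneg_iff_isPositive _).1 (CFC.sqrt_nonneg ρ)
  have hsymm : ∀ x y, inner ℂ (CFC.sqrt ρ x) y = inner ℂ x (CFC.sqrt ρ y) :=
    fun x y => hS.isSymmetric x y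
  refine ⟨CFC.sqrt ρ, hsymm, fun x y => ?_⟩
  rw [hsymm, ← mul_apply_eq_comp, CFC.sqrt_mul_sqrt_self ρ h0]

theorem HilbertBasis.hasSum_norm_inner_sq {ι : Type*} (e : HilbertBasis ι ℂ E) (x : E) :
    HasSum (fun i => ‖inner ℂ (e i) x‖ ^ 2) (‖x‖ ^ 2) := by
  have h := (e.hasSum_inner_mul_inner x x).mapL Complex.reCLM
  have h2 : Complex.reCLM (inner ℂ x x) = ‖x‖ ^ 2 := by
    simpa using inner_self_eq_norm_sq (𝕜 := ℂ) x
  rw [h2] at h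
  convert h using 2 with i
  rw [← inner_conj_symm x (e i), ← Complex.normSq_eq_conj_mul_self, Complex.normSq_eq_norm_sq]
  exact (Complex.ofReal_re _).symm

/-- Bessel's inequality for two orthogonal vectors. -/
theorem norm_inner_sq_add_norm_inner_sq_le {φ f : E} (hφ : ‖φ‖ = 1) (hf : inner ℂ φ f = 0) (x : E) :
    ‖f‖ ^ 2 * ‖inner ℂ φ x‖ ^ 2 + ‖inner ℂ f x‖ ^ 2 ≤ ‖f‖ ^ 2 * ‖x‖ ^ 2 := by
  -- `f` sees only the part of `x` orthogonal to `φ`, so Pythagoras and Cauchy–Schwarz on that part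
  -- suffice.
  set y := x - inner ℂ φ x • φ with hy
  have h1 : inner ℂ f x = inner ℂ f y := by
    have : inner ℂ f φ = 0 := by rw [← inner_conj_symm, hf, map_zero]
    rw [hy, inner_sub_right, inner_smul_right, this, mul_zero, sub_zero]
  have h2 : inner ℂ φ y = 0 := by
    rw [hy, inner_sub_right, inner_smul_right, inner_self_eq_norm_sq_to_K, hφ]
    simp
  have h3 : ‖x‖ ^ 2 = ‖inner ℂ φ x‖ ^ 2 + ‖y‖ ^ 2 := by
    have hx : x = inner ℂ φ x • φ + y := by rw [hy]; abel
    have := norm_add_sq_eq_norm_sq_add_norm_sq_of_inner_eq_zero (𝕜 := ℂ) (inner ℂ φ x • φ) y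
      (by rw [inner_smul_left, h2, mul_zero])
    rw [← hx, norm_smul, hφ, mul_one] at this
    nlinarith
  have h4 : ‖inner ℂ f y‖ ^ 2 ≤ ‖f‖ ^ 2 * ‖y‖ ^ 2 := by
    rw [← mul_pow]
    exact pow_le_pow_left₀ (norm_nonneg _) (norm_inner_le_norm f y) 2
  rw [h1, h3]
  linarith

variable {ι : Type*} {e : HilbertBasis ι ℂ E} {S : E →L[ℂ] E}

theorem hasSum_norm_inner_map_sq (hS : ∀ x y, inner ℂ (S x) y = inner ℂ x (S y)) (f : E) :
    HasSum (fun i => ‖inner ℂ (S (e i)) f‖ ^ 2) (‖S f‖ ^ 2) := by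
  simpa only [hS] using e.hasSum_norm_inner_sq (S f)

/-- The trace of a positive operator of trace one dominates its diagonal on two orthogonal
directions. -/
theorem norm_map_sq_le_of_inner_eq_zero (hS : ∀ x y, inner ℂ (S x) y = inner ℂ x (S y))
    (he : HasSum (fun i => ‖S (e i)‖ ^ 2) 1) {φ f : E} (hφ : ‖φ‖ = 1) (hf : inner ℂ φ f = 0) :
    ‖S f‖ ^ 2 ≤ (1 - ‖S φ‖ ^ 2) * ‖f‖ ^ 2 := by
  -- Bessel for each vector `S (e i)`, summed over `i`; by symmetry and Parseval the sums are `‖S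
  -- φ‖²` and `‖S f‖²`.
  have h1 := ((hasSum_norm_inner_map_sq (e := e) hS φ).mul_left (‖f‖ ^ 2)).add
    (hasSum_norm_inner_map_sq (e := e) hS f)
  have h2 := hasSum_le (fun i => ?_) h1 (he.mul_left (‖f‖ ^ 2))
  · linarith
  · have := norm_inner_sq_add_norm_inner_sq_le hφ hf (S (e i))
    rwa [norm_inner_symm φ, norm_inner_symm f] at this

theorem norm_map_sq_le_norm_sq (hS : ∀ x y, inner ℂ (S x) y = inner ℂ x (S y))
    (he : HasSum (fun i => ‖S (e i)‖ ^ 2) 1) (f : E) : ‖S f‖ ^ 2 ≤ ‖f‖ ^ 2 := by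
  rw [← mul_one (‖f‖ ^ 2)]
  refine hasSum_le (fun i => ?_) (hasSum_norm_inner_map_sq (e := e) hS f) (he.mul_left (‖f‖ ^ 2))
  rw [← mul_pow, mul_comm]
  exact pow_le_pow_left₀ (norm_nonneg _) (norm_inner_le_norm _ _) 2

/-- A Hilbert–Schmidt operator maps bounded weakly null families to norm null ones. -/
theorem tendsto_norm_map_sq_of_tendsto_inner (hS : ∀ x y, inner ℂ (S x) y = inner ℂ x (S y))
    (he : HasSum (fun i => ‖S (e i)‖ ^ 2) 1) {α : Type*} {l : Filter α} {v : α → E}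
    (hv : ∀ a, ‖v a‖ = 1) (hl : ∀ g, Filter.Tendsto (fun a => inner ℂ g (v a)) l (nhds 0)) :
    Filter.Tendsto (fun a => ‖S (v a)‖ ^ 2) l (nhds 0) := by
  have h : ∀ a, ‖S (v a)‖ ^ 2 = ∑' i, ‖inner ℂ (S (e i)) (v a)‖ ^ 2 := fun a =>
    (hasSum_norm_inner_map_sq hS (v a)).tsum_eq.symm
  simp only [h]
  rw [← tsum_zero (α := ℝ) (β := ι)]
  refine tendsto_tsum_of_dominated_convergence he.summable (fun i => ?_)
    (Filter.Eventually.of_forall fun a i => ?_)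
  · simpa using ((hl (S (e i))).norm.pow 2)
  · rw [Real.norm_of_nonneg (by positivity)]
    have := norm_inner_le_norm (𝕜 := ℂ) (S (e i)) (v a)
    rw [hv, mul_one] at this
    exact pow_le_pow_left₀ (norm_nonneg _) this 2

end PositiveOperators

theorem IsDensityMatrix.exists_sqrt {ρ : L2R →L[ℂ] L2R} (h : IsDensityMatrix ρ) :
    ∃ S : L2R →L[ℂ] L2R, (∀ x y, inner ℂ (S x) y = inner ℂ x (S y)) ∧
      (∀ x y, inner ℂ x (ρ y) = inner ℂ (S x) (S y)) ∧
      ∃ (ι : Type) (e : HilbertBasis ι ℂ L2R), HasSum (fun i => ‖S (e i)‖ ^ 2) 1 := by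
  obtain ⟨hρ, ι, e, he⟩ := h
  obtain ⟨S, hS, hSρ⟩ := hρ.exists_symmetric_sqrt
  refine ⟨S, hS, hSρ, ι, e, ?_⟩
  have h := he.mapL Complex.reCLM
  simpa [hSρ, ← Complex.ofReal_pow] using h

/-! ### Unnormalized coherent states and their holomorphy -/

section CoherentStates

open Complex in
/-- The unnormalized coherent state `x ↦ 2^{1/4} e^{-πx² + 2πxζ}`, entire in `ζ`. -/
noncomputable def gaussianExpFun (ζ : ℂ) (x : ℝ) : ℂ :=
  ((2 : ℝ) ^ (1 / 4 : ℝ) : ℝ) * exp (-Real.pi * x ^ 2 + 2 * Real.pi * x * ζ)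

theorem coherentFun_eq (z : ℝ × ℝ) (x : ℝ) :
    coherentFun z x = (Real.exp (-Real.pi * z.1 ^ 2) : ℂ) * gaussianExpFun ⟨z.1, z.2⟩ x := by
  unfold coherentFun gaussianExpFun
  have : (⟨z.1, z.2⟩ : ℂ) = z.1 + z.2 * Complex.I := by
    apply Complex.ext <;> simp
  rw [this]
  push_cast
  rw [mul_left_comm, mul_left_comm ((Complex.exp _)), ← Complex.exp_add, ← Complex.exp_add]
  congr 2
  ring

theorem gaussianExpFun_eq (ζ : ℂ) (x : ℝ) :
    gaussianExpFun ζ x = (Real.exp (Real.pi * ζ.re ^ 2) : ℂ) * coherentFun (ζ.re, ζ.im) x := by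
  rw [coherentFun_eq, ← mul_assoc, ← Complex.ofReal_mul, ← Real.exp_add]
  simp

theorem memLp_gaussianExpFun (ζ : ℂ) : MemLp (gaussianExpFun ζ) 2 (volume : Measure ℝ) := by
  have : gaussianExpFun ζ = fun x => (Real.exp (Real.pi * ζ.re ^ 2) : ℂ) *
      coherentFun (ζ.re, ζ.im) x := funext (gaussianExpFun_eq ζ)
  rw [this]
  exact (memLp_coherentFun _).const_mul _

/-- The unnormalized coherent state as an element of `L²(ℝ)`. -/
noncomputable def gaussianExp (ζ : ℂ) : L2R := (memLp_gaussianExpFun ζ).toLp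

theorem coherentState_eq (z : ℝ × ℝ) :
    coherentState z = (Real.exp (-Real.pi * z.1 ^ 2) : ℂ) • gaussianExp ⟨z.1, z.2⟩ := by
  rw [coherentState, gaussianExp, ← MemLp.toLp_const_smul]
  refine MemLp.toLp_congr _ _ (Filter.Eventually.of_forall fun x => ?_)
  simpa using coherentFun_eq z x

theorem inner_gaussianExp (a b : ℂ) :
    inner ℂ (gaussianExp a) (gaussianExp b)
      = Complex.exp (Real.pi * (starRingEnd ℂ a + b) ^ 2 / 2) := by
  have h1 : inner ℂ (gaussianExp a) (gaussianExp b) =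
      ∫ x : ℝ, ((Real.sqrt 2 : ℝ) : ℂ) * Complex.exp (-(2 * Real.pi : ℂ) * x ^ 2 +
        2 * Real.pi * (starRingEnd ℂ a + b) * x + 0) := by
    rw [L2.inner_def]
    refine integral_congr_ae ?_
    filter_upwards [(memLp_gaussianExpFun a).coeFn_toLp, (memLp_gaussianExpFun b).coeFn_toLp]
      with x hx hy
    rw [gaussianExp, gaussianExp, hx, hy, gaussianExpFun, gaussianExpFun, RCLike.inner_apply,
      map_mul, ← Complex.exp_conj, Complex.conj_ofReal, mul_mul_mul_comm, ← Complex.exp_add,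
      ← Complex.ofReal_mul, ← Real.rpow_add (by norm_num), Real.sqrt_eq_rpow]
    simp only [map_add, map_mul, map_neg, map_pow, Complex.conj_ofReal, map_ofNat]
    congr 2
    · norm_num
    · ring
  rw [h1, integral_const_mul, integral_cexp_quadratic (by simp [Real.pi_pos])]
  have h2 : (Real.pi / -(-(2 * Real.pi : ℂ))) = ((1 / 2 : ℝ) : ℂ) := by
    push_cast
    field_simp [Complex.ofReal_ne_zero.2 Real.pi_ne_zero]
  have h3 : ((1 / 2 : ℝ) : ℂ) ^ (1 / 2 : ℂ) = ((Real.sqrt (1 / 2) : ℝ) : ℂ) := by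
    rw [Real.sqrt_eq_rpow, Complex.ofReal_cpow (by norm_num)]
    norm_num
  rw [h2, h3, ← mul_assoc, ← Complex.ofReal_mul, ← Real.sqrt_mul (by norm_num)]
  have hpi := Complex.ofReal_ne_zero.2 Real.pi_ne_zero
  norm_num
  congr 1
  field_simp
  ring

theorem norm_gaussianExp_sq (ζ : ℂ) :
    ‖gaussianExp ζ‖ ^ 2 = Real.exp (2 * Real.pi * ζ.re ^ 2) := by
  have h := inner_self_eq_norm_sq (𝕜 := ℂ) (gaussianExp ζ)
  rw [← h, inner_gaussianExp, add_comm, Complex.add_conj]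
  have : (Real.pi * ((2 * ζ.re : ℝ) : ℂ) ^ 2 / 2) = ((2 * Real.pi * ζ.re ^ 2 : ℝ) : ℂ) := by
    push_cast; ring
  rw [this]
  exact Complex.exp_ofReal_re _

theorem norm_gaussianExpFun (ζ : ℂ) (x : ℝ) :
    ‖gaussianExpFun ζ x‖ =
      (2 : ℝ) ^ (1 / 4 : ℝ) * Real.exp (-Real.pi * x ^ 2 + 2 * Real.pi * x * ζ.re) := by
  rw [gaussianExpFun, norm_mul, Complex.norm_exp, Complex.norm_real,
    Real.norm_of_nonneg (by positivity)]
  congr 2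
  have : (-(Real.pi : ℂ) * x ^ 2 + 2 * Real.pi * x * ζ) =
      ((-Real.pi * x ^ 2 : ℝ) : ℂ) + ((2 * Real.pi * x : ℝ) : ℂ) * ζ := by push_cast; ring
  rw [this, Complex.add_re, Complex.ofReal_re, Complex.re_ofReal_mul]

theorem hasDerivAt_gaussianExpFun (ζ : ℂ) (x : ℝ) :
    HasDerivAt (fun ζ => gaussianExpFun ζ x) (2 * Real.pi * x * gaussianExpFun ζ x) ζ := by
  unfold gaussianExpFun
  have h := ((((hasDerivAt_id ζ).const_mul (2 * Real.pi * x : ℂ)).const_add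
    (-(Real.pi : ℂ) * x ^ 2)).cexp).const_mul (((2 : ℝ) ^ (1 / 4 : ℝ) : ℝ) : ℂ)
  refine h.congr_deriv ?_
  simp only [id]
  ring

theorem differentiable_inner_gaussianExp (g : L2R) :
    Differentiable ℂ fun ζ => inner ℂ g (gaussianExp ζ) := by
  intro ζ₀
  have h1 : ∀ ζ, inner ℂ g (gaussianExp ζ) = ∫ x, starRingEnd ℂ (g x) * gaussianExpFun ζ x := by
    intro ζ
    rw [L2.inner_def]
    refine integral_congr_ae ?_
    filter_upwards [(memLp_gaussianExpFun ζ).coeFn_toLp] with x hx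
    rw [gaussianExp, hx, RCLike.inner_apply, mul_comm]
  have hint : ∀ ζ, Integrable (fun x => starRingEnd ℂ (g x) * gaussianExpFun ζ x) := by
    intro ζ
    exact (Lp.memLp g).star.integrable_mul (memLp_gaussianExpFun ζ)
  -- On the unit ball about `ζ₀` one has `|Re ζ| ≤ c - 1`. The spare unit absorbs the factor `2π|x|
  -- ≤ e^{2π|x|}` from differentiation; both `c` and `-c` are needed for the two signs of `x`.
  set c : ℝ := ‖ζ₀‖ + 2 with hc
  have hbi : Integrable (fun x => ‖starRingEnd ℂ (g x) * gaussianExpFun (c : ℂ) x‖ +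
      ‖starRingEnd ℂ (g x) * gaussianExpFun (-c : ℂ) x‖) := (hint _).norm.add (hint _).norm
  have hm : ∀ ζ, AEStronglyMeasurable (fun x => starRingEnd ℂ (g x) * gaussianExpFun ζ x) volume :=
    fun ζ => (hint ζ).aestronglyMeasurable
  refine (DifferentiableAt.congr_of_eventuallyEq ?_ (Filter.Eventually.of_forall h1))
  refine (hasDerivAt_integral_of_dominated_loc_of_deriv_le
    (F' := fun ζ x => 2 * Real.pi * x * (starRingEnd ℂ (g x) * gaussianExpFun ζ x))
    (Metric.ball_mem_nhds ζ₀ one_pos) (Filter.Eventually.of_forall hm)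
    (hint ζ₀) ?_ (Filter.Eventually.of_forall fun x ζ hζ => ?_) hbi
    (Filter.Eventually.of_forall fun x ζ _ => ?_)).2.differentiableAt
  · exact AEStronglyMeasurable.mul (by fun_prop) (hm ζ₀)
  · have hre : |ζ.re| ≤ c - 1 := by
      have h2 : ‖ζ‖ ≤ ‖ζ₀‖ + ‖ζ - ζ₀‖ := by
        simpa using norm_add_le ζ₀ (ζ - ζ₀)
      have h3 : ‖ζ - ζ₀‖ < 1 := by simpa [dist_eq_norm] using hζ
      have := Complex.abs_re_le_norm ζ
      rw [hc]; linarith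
    have key : 2 * Real.pi * |x| * ‖gaussianExpFun ζ x‖ ≤
        ‖gaussianExpFun (c : ℂ) x‖ + ‖gaussianExpFun (-c : ℂ) x‖ := by
      simp only [norm_gaussianExpFun, Complex.neg_re, Complex.ofReal_re]
      rw [← mul_add, mul_left_comm]
      refine mul_le_mul_of_nonneg_left ?_ (by positivity)
      have e1 : 2 * Real.pi * |x| ≤ Real.exp (2 * Real.pi * |x|) :=
        (by linarith [Real.add_one_le_exp (2 * Real.pi * |x|)])
      have e2 : x * ζ.re ≤ |x| * (c - 1) := by
        calc x * ζ.re ≤ |x * ζ.re| := le_abs_self _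
          _ = |x| * |ζ.re| := abs_mul _ _
          _ ≤ _ := mul_le_mul_of_nonneg_left hre (abs_nonneg x)
      have e3 : 2 * Real.pi * |x| * Real.exp (-Real.pi * x ^ 2 + 2 * Real.pi * x * ζ.re) ≤
          Real.exp (-Real.pi * x ^ 2 + 2 * Real.pi * |x| * c) := by
        calc _ ≤ Real.exp (2 * Real.pi * |x|) *
              Real.exp (-Real.pi * x ^ 2 + 2 * Real.pi * x * ζ.re) :=
              mul_le_mul_of_nonneg_right e1 (Real.exp_pos _).le
          _ = Real.exp (2 * Real.pi * |x| + (-Real.pi * x ^ 2 + 2 * Real.pi * x * ζ.re)) :=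
              (Real.exp_add _ _).symm
          _ ≤ _ := by
              apply Real.exp_le_exp.2
              nlinarith [Real.pi_pos]
      refine e3.trans ?_
      rcases abs_cases x with ⟨hx, _⟩ | ⟨hx, _⟩ <;> rw [hx]
      · linarith [Real.exp_pos (-Real.pi * x ^ 2 + 2 * Real.pi * x * -c)]
      · rw [show 2 * Real.pi * -x * c = 2 * Real.pi * x * -c by ring]
        linarith [Real.exp_pos (-Real.pi * x ^ 2 + 2 * Real.pi * x * c)]
    have e4 : ‖(2 * Real.pi * x : ℂ)‖ = 2 * Real.pi * |x| := by
      simp [abs_of_pos Real.pi_pos]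
    rw [norm_mul, e4, norm_mul, norm_mul, norm_mul, ← mul_add, mul_left_comm]
    exact mul_le_mul_of_nonneg_left key (norm_nonneg _)
  · refine ((hasDerivAt_gaussianExpFun ζ x).const_mul _).congr_deriv ?_
    ring

end CoherentStates

/-! ### Area of perturbed discs -/

section AreaEstimate

theorem lintegral_ofReal_Ioc_zero {a : ℝ} (ha : 0 ≤ a) :
    ∫⁻ r in Set.Ioc 0 a, ENNReal.ofReal r = ENNReal.ofReal (a ^ 2 / 2) := by
  rw [← ofReal_integral_eq_lintegral_ofReal]
  · rw [← intervalIntegral.integral_of_le ha, integral_id]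
    norm_num
  · exact (continuous_id.integrableOn_Icc (a := (0 : ℝ)) (b := a)).mono_set Set.Ioc_subset_Icc_self
  · exact (ae_restrict_mem measurableSet_Ioc).mono fun r hr => hr.1.le

/-- The area of a region inside the star-shaped domain `πr² ≤ g(θ)`. -/
theorem volume_le_of_polar_bound {s : Set (ℝ × ℝ)} (hs : MeasurableSet s) {g : ℝ → ℝ}
    (hg : Continuous g) (hg0 : ∀ θ, 0 ≤ g θ)
    (h : ∀ r θ : ℝ, 0 < r → (r * Real.cos θ, r * Real.sin θ) ∈ s → Real.pi * r ^ 2 ≤ g θ) :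
    volume s ≤ ENNReal.ofReal ((2 * Real.pi)⁻¹ * ∫ θ in (-Real.pi)..Real.pi, g θ) := by
  have hpi := Real.pi_pos
  set D : Set (ℝ × ℝ) := {p | p.1 ≤ Real.sqrt (g p.2 / Real.pi)} with hD
  have hDm : MeasurableSet D := (isClosed_le (by fun_prop) (by fun_prop)).measurableSet
  calc volume s = ∫⁻ p, s.indicator 1 p := (lintegral_indicator_one hs).symm
    _ = ∫⁻ p in polarCoord.target, ENNReal.ofReal p.1 • s.indicator 1 (polarCoord.symm p) :=
        (lintegral_comp_polarCoord_symm _).symm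
    _ ≤ ∫⁻ p in polarCoord.target, D.indicator (fun p => ENNReal.ofReal p.1) p := by
        refine setLIntegral_mono' (polarCoord.open_target.measurableSet) fun p hp => ?_
        have hp1 : 0 < p.1 := hp.1
        by_cases hps : polarCoord.symm p ∈ s
        · have hpD : p ∈ D := by
            rw [hD, Set.mem_ofPred_eq]
            apply Real.le_sqrt_of_sq_le
            rw [le_div_iff₀ hpi, mul_comm]
            exact h p.1 p.2 hp1 hps
          rw [Set.indicator_of_mem hps, Set.indicator_of_mem hpD]
          simp
        · rw [Set.indicator_of_notMem hps]
          simp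
    _ = ∫⁻ θ in Set.Ioo (-Real.pi) Real.pi, ∫⁻ r in Set.Ioi 0,
          D.indicator (fun p => ENNReal.ofReal p.1) (r, θ) := by
        have : polarCoord.target = Set.Ioi (0 : ℝ) ×ˢ Set.Ioo (-Real.pi) Real.pi := rfl
        rw [this, Measure.volume_eq_prod, ← Measure.prod_restrict, lintegral_prod_symm]
        exact ((by fun_prop : Measurable fun p : ℝ × ℝ => ENNReal.ofReal p.1).indicator
          hDm).aemeasurable
    _ = ∫⁻ θ in Set.Ioo (-Real.pi) Real.pi, ENNReal.ofReal ((2 * Real.pi)⁻¹ * g θ) := by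
        refine lintegral_congr fun θ => ?_
        have h1 : ∀ r : ℝ, D.indicator (fun p => ENNReal.ofReal p.1) (r, θ) =
            (Set.Iic (Real.sqrt (g θ / Real.pi))).indicator (fun r => ENNReal.ofReal r) r :=
          fun r => by simp only [Set.indicator, hD, Set.mem_ofPred_eq, Set.mem_Iic]
        simp only [h1]
        rw [lintegral_indicator measurableSet_Iic, Measure.restrict_restrict measurableSet_Iic,
          Set.Iic_inter_Ioi, lintegral_ofReal_Ioc_zero (Real.sqrt_nonneg _),
          Real.sq_sqrt (div_nonneg (hg0 θ) hpi.le)]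
        congr 1
        field_simp
    _ = ENNReal.ofReal ((2 * Real.pi)⁻¹ * ∫ θ in (-Real.pi)..Real.pi, g θ) := by
        rw [← ofReal_integral_eq_lintegral_ofReal, ← integral_Ioc_eq_integral_Ioo,
          ← intervalIntegral.integral_of_le (by linarith), intervalIntegral.integral_const_mul]
        · exact ((hg.const_mul _).integrableOn_Icc (a := -Real.pi) (b := Real.pi)).mono_set
            Set.Ioo_subset_Icc_self
        · exact Filter.Eventually.of_forall fun θ => mul_nonneg (by positivity) (hg0 θ)

/-- Mean value property for the real part of an entire function. -/
theorem integral_re_circle_eq {F : ℂ → ℂ} (hF : Differentiable ℂ F) (h0 : F 0 = 0) (r : ℝ) :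
    ∫ θ in (-Real.pi)..Real.pi, (F (r * Complex.exp (θ * Complex.I))).re = 0 := by
  have h1 : Real.circleAverage F 0 r = 0 := by
    rw [hF.diffContOnCl.circleAverage, h0]
  have hcont : Continuous fun θ : ℝ => F (r * Complex.exp (θ * Complex.I)) :=
    hF.continuous.comp (by fun_prop)
  have h2 : ∫ θ in (0 : ℝ)..2 * Real.pi, F (r * Complex.exp (θ * Complex.I)) = 0 := by
    rw [Real.circleAverage_def] at h1
    have := (smul_eq_zero.1 h1).resolve_left (by positivity)
    simpa [circleMap] using this
  have hper : Function.Periodic (fun θ : ℝ => F (r * Complex.exp (θ * Complex.I)))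
      (2 * Real.pi) := by
    intro θ
    simp only [Complex.ofReal_add, add_mul, Complex.exp_add]
    congr 2
    push_cast
    rw [Complex.exp_two_pi_mul_I, mul_one]
  have h3 := hper.intervalIntegral_add_eq (-Real.pi) 0
  rw [zero_add, h2, show -Real.pi + 2 * Real.pi = Real.pi by ring] at h3
  have h4 := Complex.reCLM.intervalIntegral_comp_comm
    (hcont.intervalIntegrable (μ := volume) (-Real.pi) Real.pi)
  rw [h3] at h4
  simpa using h4

section SecondOrderZero

variable {F : ℂ → ℂ} {N R : ℝ}

/-- Cauchy's estimates for an entire function vanishing to second order at the origin. -/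
theorem norm_deriv_le_of_deriv_zero (hF : Differentiable ℂ F) (h1 : deriv F 0 = 0)
    (hN : ∀ w, ‖w‖ ≤ R + 2 → ‖F w‖ ≤ N) {w : ℂ} (hw : ‖w‖ ≤ R) : ‖deriv F w‖ ≤ N * ‖w‖ := by
  -- Each Cauchy estimate uses circles of radius one: the bound on `R + 2` passes to `F'` on `R + 1`
  -- and to `F''` on `R`.
  have hd : ∀ w, ‖w‖ ≤ R + 1 → ‖deriv F w‖ ≤ N := fun w hw => by
    have := Complex.norm_deriv_le_of_forall_mem_sphere_norm_le (c := w) (C := N) one_pos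
      hF.diffContOnCl fun z hz => hN z (by
        have h2 : ‖z - w‖ = 1 := by simpa [dist_eq_norm] using hz
        have h3 := norm_add_le w (z - w)
        rw [add_sub_cancel] at h3
        linarith)
    simpa using this
  have hF' : Differentiable ℂ (deriv F) := fun z => (hF.analyticAt z).deriv.differentiableAt
  have hdd : ∀ w ∈ Metric.closedBall (0 : ℂ) R, ‖deriv (deriv F) w‖ ≤ N := fun w hw => by
    have hw' : ‖w‖ ≤ R := by simpa using hw
    have := Complex.norm_deriv_le_of_forall_mem_sphere_norm_le (c := w) (C := N) one_pos
      hF'.diffContOnCl fun z hz => hd z (by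
        have h2 : ‖z - w‖ = 1 := by simpa [dist_eq_norm] using hz
        have h3 := norm_add_le w (z - w)
        rw [add_sub_cancel] at h3
        linarith)
    simpa using this
  have := (convex_closedBall (0 : ℂ) R).norm_image_sub_le_of_norm_deriv_le
    (fun z _ => hF' z) hdd (Metric.mem_closedBall_self ((norm_nonneg w).trans hw))
    (show w ∈ Metric.closedBall (0 : ℂ) R by simpa using hw)
  simpa [h1] using this

/-- On the disc of radius `m` the derivative is at most `N * m`; this factor `m` makes a change of
radius by `δ * r₀` cost only `O(δ² r₀²)`. -/
theorem norm_sub_le_of_deriv_zero (hF : Differentiable ℂ F) (h1 : deriv F 0 = 0)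
    (hN : ∀ w, ‖w‖ ≤ R + 2 → ‖F w‖ ≤ N) {m : ℝ} (hm : m ≤ R) {a b : ℂ} (ha : ‖a‖ ≤ m)
    (hb : ‖b‖ ≤ m) : ‖F a - F b‖ ≤ N * m * ‖a - b‖ := by
  have hN0 : 0 ≤ N := (norm_nonneg _).trans (hN a (by linarith))
  refine (convex_closedBall (0 : ℂ) m).norm_image_sub_le_of_norm_deriv_le
    (fun z _ => hF z) (fun w hw => ?_) (show b ∈ Metric.closedBall (0 : ℂ) m by simpa using hb)
    (show a ∈ Metric.closedBall (0 : ℂ) m by simpa using ha)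
  have hw' : ‖w‖ ≤ m := by simpa using hw
  exact (norm_deriv_le_of_deriv_zero hF h1 hN (hw'.trans hm)).trans
    (mul_le_mul_of_nonneg_left hw' hN0)

theorem norm_le_of_deriv_zero (hF : Differentiable ℂ F) (h0 : F 0 = 0) (h1 : deriv F 0 = 0)
    (hN : ∀ w, ‖w‖ ≤ R + 2 → ‖F w‖ ≤ N) {w : ℂ} (hw : ‖w‖ ≤ R) : ‖F w‖ ≤ N * ‖w‖ ^ 2 := by
  have := norm_sub_le_of_deriv_zero hF h1 hN hw le_rfl (b := 0) (by simp)
  simpa [h0, pow_two, mul_assoc] using this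

/-- Along a ray, a perturbation of `πr² ≤ s` by a function with a second order zero can be
evaluated on the unperturbed circle, up to a quadratic error. -/
theorem pi_mul_sq_le_of_perturbation (hF : Differentiable ℂ F) (h0 : F 0 = 0)
    (h1 : deriv F 0 = 0) (hN : ∀ w, ‖w‖ ≤ R + 2 → ‖F w‖ ≤ N) {A : ℝ} (hA : 0 ≤ A)
    (hNA : N + A ≤ 1) {r r₀ : ℝ} (hr : 0 ≤ r) (hrR : r ≤ R) (hr₀ : 0 ≤ r₀) (hr₀R : r₀ ≤ R)
    {e : ℂ} (he : ‖e‖ = 1)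
    (h : Real.pi * r ^ 2 ≤ Real.pi * r₀ ^ 2 + (F (r * e)).re + A * r ^ 2) :
    Real.pi * r ^ 2 ≤ Real.pi * r₀ ^ 2 + (F (r₀ * e)).re +
      (2 * (N + A) ^ 2 + 2 * A) * r₀ ^ 2 := by
  have hpi := Real.pi_gt_three
  have hN0 : 0 ≤ N := (norm_nonneg _).trans (hN 0 (by simp; linarith))
  have hnorm : ∀ r : ℝ, 0 ≤ r → ‖(r : ℂ) * e‖ = r := fun r hr => by
    rw [norm_mul, he, Complex.norm_real, Real.norm_of_nonneg hr, mul_one]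
  have hFr := norm_le_of_deriv_zero hF h0 h1 hN (w := r * e) (by rwa [hnorm r hr])
  have hFr₀ := norm_le_of_deriv_zero hF h0 h1 hN (w := r₀ * e) (by rwa [hnorm r₀ hr₀])
  rw [hnorm r hr] at hFr
  rw [hnorm r₀ hr₀] at hFr₀
  have hre := (Complex.abs_re_le_norm _).trans hFr
  have hre₀ := (Complex.abs_re_le_norm _).trans hFr₀
  rw [abs_le] at hre hre₀
  set δ := N + A with hδ
  have hδ0 : 0 ≤ δ := by positivity
  -- The perturbation at `r` is at most `δ * r ^ 2`, and `π - δ > 1`.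
  have hupper : r ^ 2 - r₀ ^ 2 ≤ δ * r₀ ^ 2 := by
    have e1 : (Real.pi - δ) * r ^ 2 ≤ Real.pi * r₀ ^ 2 := by rw [hδ]; nlinarith
    have e2 : (Real.pi - δ) * (r ^ 2 - r₀ ^ 2) ≤ δ * r₀ ^ 2 := by linarith
    by_contra! hc
    have e3 : 0 ≤ δ * r₀ ^ 2 := by positivity
    nlinarith
  -- For small `r` the gap `πδr₀²` exceeds the largest possible loss `N * r₀ ^ 2` from `F (r₀ * e)`.
  -- Otherwise `|r - r₀| ≤ δ * r₀`, and moving `F` to radius `r₀` costs at most `2δ²r₀²`.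
  rcases le_or_gt (r ^ 2) ((1 - δ) * r₀ ^ 2) with hsmall | hlarge
  · have : 0 ≤ (2 * δ ^ 2 + 2 * A) * r₀ ^ 2 := by positivity
    have h3 : 0 ≤ δ * r₀ ^ 2 := by positivity
    have h4 : N * r₀ ^ 2 ≤ δ * r₀ ^ 2 := mul_le_mul_of_nonneg_right (by linarith) (sq_nonneg _)
    nlinarith
  · have hr2 : r ≤ 2 * r₀ := by
      apply le_of_sq_le_sq _ (by linarith)
      nlinarith [sq_nonneg r₀]
    have hdiff : |r - r₀| ≤ δ * r₀ := by
      rcases hr₀.eq_or_lt with hz | hpos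
      · have : r = 0 := by linarith
        rw [this, ← hz]; simp
      · rw [abs_le]
        constructor
        · by_contra! hc
          nlinarith [mul_nonneg hδ0 hr₀]
        · by_contra! hc
          nlinarith [mul_nonneg hδ0 hr₀]
    have hmR : max r r₀ ≤ R := max_le hrR hr₀R
    have hm2 : max r r₀ ≤ 2 * r₀ := max_le hr2 (by linarith)
    have hd := norm_sub_le_of_deriv_zero hF h1 hN hmR (a := r * e) (b := r₀ * e)
      (by rw [hnorm r hr]; exact le_max_left _ _) (by rw [hnorm r₀ hr₀]; exact le_max_right _ _)
    have hdn : ‖(r : ℂ) * e - r₀ * e‖ = |r - r₀| := by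
      rw [← sub_mul, norm_mul, he, mul_one, ← Complex.ofReal_sub, Complex.norm_real,
        Real.norm_eq_abs]
    rw [hdn] at hd
    have hd2 : N * max r r₀ * |r - r₀| ≤ δ * (2 * r₀) * (δ * r₀) := by
      have : N ≤ δ := by linarith
      have : 0 ≤ max r r₀ := hr.trans (le_max_left _ _)
      gcongr
    have hd3 := ((Complex.re_le_norm _).trans hd).trans hd2
    rw [Complex.sub_re] at hd3
    have hA2 : A * r ^ 2 ≤ A * (2 * r₀ ^ 2) := by
      apply mul_le_mul_of_nonneg_left _ hA
      nlinarith [sq_nonneg r₀]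
    nlinarith

/-- The area of a perturbed disc: perturbations by the real part of an entire function with a
second order zero contribute to second order only. -/
theorem volume_le_of_perturbed_disc (hF : Differentiable ℂ F) (h0 : F 0 = 0)
    (h1 : deriv F 0 = 0) (hN : ∀ w, ‖w‖ ≤ R + 2 → ‖F w‖ ≤ N) {A : ℝ} (hA : 0 ≤ A)
    (hNA : N + A ≤ 1) (hR : 0 ≤ R) {σ : ℝ} (hσ : 0 ≤ σ) (hσR : σ ≤ Real.pi * R ^ 2)
    {s : Set (ℝ × ℝ)} (hs : MeasurableSet s)
    (h : ∀ p ∈ s, ‖(⟨p.1, p.2⟩ : ℂ)‖ ≤ R ∧ Real.pi * ‖(⟨p.1, p.2⟩ : ℂ)‖ ^ 2 ≤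
      σ + (F ⟨p.1, p.2⟩).re + A * ‖(⟨p.1, p.2⟩ : ℂ)‖ ^ 2) :
    volume s ≤ ENNReal.ofReal ((1 + (2 * (N + A) ^ 2 + 2 * A)) * σ) := by
  have hpi := Real.pi_gt_three
  have hN0 : 0 ≤ N := (norm_nonneg _).trans (hN 0 (by simp; linarith))
  set r₀ := Real.sqrt (σ / Real.pi) with hr₀def
  have hr₀ : 0 ≤ r₀ := Real.sqrt_nonneg _
  have hr₀σ : Real.pi * r₀ ^ 2 = σ := by
    rw [hr₀def, Real.sq_sqrt (by positivity)]
    field_simp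
  have hr₀R : r₀ ≤ R := le_of_sq_le_sq (by nlinarith) hR
  set B := 2 * (N + A) ^ 2 + 2 * A with hB
  have hB0 : 0 ≤ B := by positivity
  -- `F` is evaluated on one fixed circle, so its real part integrates to zero.
  set g : ℝ → ℝ := fun θ => σ + (F (r₀ * Complex.exp (θ * Complex.I))).re + B * σ with hg
  have hFc : Continuous fun θ : ℝ => (F (r₀ * Complex.exp (θ * Complex.I))).re :=
    Complex.continuous_re.comp (hF.continuous.comp (by fun_prop))
  have hgc : Continuous g := (continuous_const.add hFc).add continuous_const
  have hg0 : ∀ θ, 0 ≤ g θ := fun θ => by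
    have hn : ‖(r₀ : ℂ) * Complex.exp (θ * Complex.I)‖ = r₀ := by
      rw [norm_mul, Complex.norm_exp_ofReal_mul_I, Complex.norm_real, Real.norm_of_nonneg hr₀,
        mul_one]
    have := norm_le_of_deriv_zero hF h0 h1 hN (w := r₀ * Complex.exp (θ * Complex.I))
      (by rwa [hn])
    rw [hn] at this
    have h2 := (abs_le.1 ((Complex.abs_re_le_norm _).trans this)).1
    have h3 : 0 ≤ B * σ := by positivity
    simp only [hg]
    nlinarith [sq_nonneg r₀]
  refine (volume_le_of_polar_bound hs hgc hg0 fun r θ hr hmem => ?_).trans_eq ?_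
  · have hz : (⟨r * Real.cos θ, r * Real.sin θ⟩ : ℂ) = r * Complex.exp (θ * Complex.I) := by
      apply Complex.ext <;>
        simp [Complex.exp_ofReal_mul_I_re, Complex.exp_ofReal_mul_I_im]
    obtain ⟨ha, hb⟩ := h _ hmem
    simp only [hz] at ha hb
    rw [norm_mul, Complex.norm_exp_ofReal_mul_I, Complex.norm_real, Real.norm_of_nonneg hr.le,
      mul_one] at ha hb
    rw [← hr₀σ] at hb
    have := pi_mul_sq_le_of_perturbation hF h0 h1 hN hA hNA hr.le ha hr₀ hr₀R
      (Complex.norm_exp_ofReal_mul_I θ) hb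
    simp only [hg]
    rw [hr₀σ] at this
    have h5 : B * r₀ ^ 2 ≤ B * σ := mul_le_mul_of_nonneg_left (by nlinarith [sq_nonneg r₀]) hB0
    linarith
  · congr 1
    simp only [hg]
    have hi : IntervalIntegrable (fun θ : ℝ => σ + (F (r₀ * Complex.exp (θ * Complex.I))).re)
      volume (-Real.pi) Real.pi := (continuous_const.add hFc).intervalIntegrable _ _
    rw [intervalIntegral.integral_add hi
      (continuous_const.intervalIntegrable _ _), intervalIntegral.integral_add
      (continuous_const.intervalIntegrable _ _) (hFc.intervalIntegrable _ _),
      integral_re_circle_eq hF h0]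
    simp
    field_simp
    ring

end SecondOrderZero

end AreaEstimate

/-! ### Coherent states recentred at a point; continuity and weak decay -/

section RecentredStates

/-- The coherent state at `z + w`, rescaled so as to be entire in `w` with value `φ_z` at `0`. -/
noncomputable def recentredState (z : ℝ × ℝ) (w : ℂ) : L2R :=
  Complex.exp (-Real.pi * z.1 ^ 2 - 2 * Real.pi * z.1 * w - Real.pi * w ^ 2 / 2) •
    gaussianExp (⟨z.1, z.2⟩ + w)

theorem recentredState_zero (z : ℝ × ℝ) : recentredState z 0 = coherentState z := by
  rw [recentredState, coherentState_eq]
  simp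

theorem differentiable_inner_recentredState (g : L2R) (z : ℝ × ℝ) :
    Differentiable ℂ fun w => inner ℂ g (recentredState z w) := by
  simp only [recentredState, inner_smul_right]
  exact Differentiable.mul (by fun_prop)
    ((differentiable_inner_gaussianExp g).comp (by fun_prop))

/-- The holomorphic prefactor cancels everything in the Gaussian Gram exponent except the mixed
term, leaving the Fock space kernel whatever the centre. Taking `v = 0` gives orthogonality of
increments to `φ_z`. -/
theorem inner_recentredState (z : ℝ × ℝ) (v w : ℂ) :
    inner ℂ (recentredState z v) (recentredState z w) =
      Complex.exp (Real.pi * (starRingEnd ℂ v * w)) := by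
  rw [recentredState, recentredState, inner_smul_left, inner_smul_right, inner_gaussianExp,
    ← Complex.exp_conj, ← Complex.exp_add, ← Complex.exp_add]
  congr 1
  simp only [map_sub, map_add, map_mul, map_neg, map_pow, map_div₀, Complex.conj_ofReal, map_ofNat]
  have : starRingEnd ℂ (⟨z.1, z.2⟩ : ℂ) + ⟨z.1, z.2⟩ = 2 * z.1 := by
    rw [add_comm, Complex.add_conj]; simp
  rw [show starRingEnd ℂ (⟨z.1, z.2⟩ : ℂ) + starRingEnd ℂ v + (⟨z.1, z.2⟩ + w) =
    (starRingEnd ℂ (⟨z.1, z.2⟩ : ℂ) + ⟨z.1, z.2⟩) + (starRingEnd ℂ v + w) by ring, this]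
  ring

theorem norm_recentredState_sq (z : ℝ × ℝ) (w : ℂ) :
    ‖recentredState z w‖ ^ 2 = Real.exp (Real.pi * ‖w‖ ^ 2) := by
  have h := inner_self_eq_norm_sq (𝕜 := ℂ) (recentredState z w)
  rw [← h, inner_recentredState, ← Complex.normSq_eq_conj_mul_self, Complex.normSq_eq_norm_sq,
    ← Complex.ofReal_mul]
  exact Complex.exp_ofReal_re _

theorem norm_coherentState (z : ℝ × ℝ) : ‖coherentState z‖ = 1 := by
  have h := norm_recentredState_sq z 0
  rw [recentredState_zero] at h
  have h2 : ‖coherentState z‖ ^ 2 = 1 := by simpa using h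
  exact (pow_eq_one_iff_of_nonneg (norm_nonneg _) two_ne_zero).1 h2

theorem inner_coherentState_recentredState (z : ℝ × ℝ) (w : ℂ) :
    inner ℂ (coherentState z) (recentredState z w) = 1 := by
  rw [← recentredState_zero, inner_recentredState]
  simp

theorem exists_unimodular_coherentState_add (z p : ℝ × ℝ) :
    ∃ c : ℂ, ‖c‖ = Real.exp (-Real.pi * ‖(⟨p.1, p.2⟩ : ℂ)‖ ^ 2 / 2) ∧
      coherentState (z + p) = c • recentredState z ⟨p.1, p.2⟩ := by
  set w : ℂ := ⟨p.1, p.2⟩ with hw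
  set a : ℂ := -Real.pi * z.1 ^ 2 - 2 * Real.pi * z.1 * w - Real.pi * w ^ 2 / 2 with ha
  have hadd : (⟨(z + p).1, (z + p).2⟩ : ℂ) = ⟨z.1, z.2⟩ + w := by
    apply Complex.ext <;> simp [hw]
  have h1 : coherentState (z + p) =
      ((Real.exp (-Real.pi * (z + p).1 ^ 2) : ℂ) * Complex.exp (-a)) • recentredState z w := by
    rw [recentredState, ← ha, smul_smul, mul_assoc, ← Complex.exp_add, neg_add_cancel,
      Complex.exp_zero, mul_one, coherentState_eq, hadd]
  refine ⟨_, ?_, h1⟩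
  -- Only the modulus of the factor matters, and comparing norms determines it.
  have h2 := congrArg norm h1
  rw [norm_coherentState, norm_smul] at h2
  have h3 : ‖recentredState z w‖ = Real.exp (Real.pi * ‖w‖ ^ 2 / 2) := by
    have := norm_recentredState_sq z w
    rw [← Real.sqrt_sq (norm_nonneg (recentredState z w)), this, Real.exp_half]
  rw [h3] at h2
  rw [show -Real.pi * ‖w‖ ^ 2 / 2 = -(Real.pi * ‖w‖ ^ 2 / 2) by ring, Real.exp_neg]
  exact eq_inv_of_mul_eq_one_left h2.symm

theorem norm_map_coherentState_add_sq (S : L2R →L[ℂ] L2R) (z p : ℝ × ℝ) :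
    ‖S (coherentState (z + p))‖ ^ 2 = Real.exp (-Real.pi * ‖(⟨p.1, p.2⟩ : ℂ)‖ ^ 2) *
      ‖S (recentredState z ⟨p.1, p.2⟩)‖ ^ 2 := by
  obtain ⟨c, hc, h⟩ := exists_unimodular_coherentState_add z p
  rw [h, map_smul, norm_smul, mul_pow, hc, ← Real.exp_nat_mul]
  congr 2
  push_cast
  ring

theorem norm_inner_coherentState_add (z p : ℝ × ℝ) :
    ‖inner ℂ (coherentState z) (coherentState (z + p))‖ =
      Real.exp (-Real.pi * ‖(⟨p.1, p.2⟩ : ℂ)‖ ^ 2 / 2) := by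
  obtain ⟨c, hc, h⟩ := exists_unimodular_coherentState_add z p
  rw [h, inner_smul_right, inner_coherentState_recentredState, mul_one, hc]

theorem continuous_gaussianExp : Continuous gaussianExp := by
  rw [continuous_iff_continuousAt]
  intro a
  have h : ∀ b, ‖gaussianExp b - gaussianExp a‖ ^ 2 =
      Real.exp (2 * Real.pi * b.re ^ 2) -
      2 * (Complex.exp (Real.pi * (starRingEnd ℂ b + a) ^ 2 / 2)).re +
      Real.exp (2 * Real.pi * a.re ^ 2) := fun b => by
    rw [@norm_sub_sq ℂ, norm_gaussianExp_sq, norm_gaussianExp_sq, inner_gaussianExp]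
    rfl
  have h2 : Continuous fun b => ‖gaussianExp b - gaussianExp a‖ ^ 2 := by
    simp only [h]
    have := Complex.continuous_re
    have := Complex.continuous_conj
    fun_prop
  have h3 : Filter.Tendsto (fun b => Real.sqrt (‖gaussianExp b - gaussianExp a‖ ^ 2)) (nhds a)
      (nhds 0) := by
    have := (h2.sqrt).tendsto a
    simpa using this
  simp only [Real.sqrt_sq (norm_nonneg _)] at h3
  exact tendsto_iff_norm_sub_tendsto_zero.2 h3

theorem continuous_coherentState : Continuous coherentState := by
  have h : coherentState = fun z : ℝ × ℝ => (Real.exp (-Real.pi * z.1 ^ 2) : ℂ) •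
      gaussianExp (z.1 + z.2 * Complex.I) := by
    funext z
    rw [coherentState_eq, Complex.mk_eq_add_mul_I]
  rw [h]
  have h1 : Continuous fun z : ℝ × ℝ => (z.1 + z.2 * Complex.I : ℂ) := by fun_prop
  have h2 : Continuous fun z : ℝ × ℝ => (Real.exp (-Real.pi * z.1 ^ 2) : ℂ) := by fun_prop
  exact h2.smul (continuous_gaussianExp.comp h1)

/-- Coherent states tend weakly to zero at infinity. -/
theorem tendsto_inner_coherentState_cocompact (g : L2R) :
    Filter.Tendsto (fun z => inner ℂ g (coherentState z)) (Filter.cocompact (ℝ × ℝ)) (nhds 0) := by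
  -- `V` is closed and contains every coherent state, so the component of `g` orthogonal to `V`
  -- contributes nothing; totality of the coherent states is not needed.
  set V : Submodule ℂ L2R :=
    { carrier := {g | Filter.Tendsto (fun z => inner ℂ g (coherentState z))
        (Filter.cocompact (ℝ × ℝ)) (nhds 0)}
      add_mem' := fun {a b} ha hb => by
        simpa [inner_add_left] using Filter.Tendsto.add ha hb
      zero_mem' := by simp
      smul_mem' := fun c a ha => by
        simpa [inner_smul_left] using Filter.Tendsto.const_mul (starRingEnd ℂ c) ha } with hV
  have hclosed : IsClosed (V : Set L2R) := by
    rw [← isSeqClosed_iff_isClosed]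
    intro x a hx hxa
    refine Metric.tendsto_nhds.2 fun ε hε => ?_
    obtain ⟨n, hn⟩ := ((Metric.tendsto_nhds.1 hxa) (ε / 2) (half_pos hε)).exists
    have hxn : Filter.Tendsto (fun z => inner ℂ (x n) (coherentState z))
      (Filter.cocompact (ℝ × ℝ)) (nhds 0) := hx n
    filter_upwards [(Metric.tendsto_nhds.1 hxn) (ε / 2) (half_pos hε)] with z hz
    rw [dist_zero_right] at hz ⊢
    have h1 : inner ℂ a (coherentState z) =
        inner ℂ (x n) (coherentState z) - inner ℂ (x n - a) (coherentState z) := by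
      rw [inner_sub_left]; ring
    have h2 := norm_inner_le_norm (𝕜 := ℂ) (x n - a) (coherentState z)
    rw [norm_coherentState, mul_one, ← dist_eq_norm] at h2
    rw [h1]
    exact (norm_sub_le _ _).trans_lt (by linarith)
  have hmem : ∀ a, coherentState a ∈ V := fun a => by
    change Filter.Tendsto _ _ _
    rw [tendsto_zero_iff_norm_tendsto_zero]
    have h1 : ∀ z : ℝ × ℝ, ‖inner ℂ (coherentState a) (coherentState z)‖ ≤
        Real.exp (-Real.pi * ‖z - a‖ ^ 2 / 2) := fun z => by
      have := norm_inner_coherentState_add a (z - a)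
      rw [add_sub_cancel] at this
      rw [this]
      apply Real.exp_le_exp.2
      have h2 : ‖z - a‖ ≤ ‖(⟨(z - a).1, (z - a).2⟩ : ℂ)‖ := by
        rw [Prod.norm_def]
        exact max_le (Complex.abs_re_le_norm ⟨(z - a).1, (z - a).2⟩)
          (Complex.abs_im_le_norm ⟨(z - a).1, (z - a).2⟩)
      have h3 := pow_le_pow_left₀ (norm_nonneg _) h2 2
      nlinarith [Real.pi_pos]
    refine squeeze_zero (fun _ => norm_nonneg _) h1 ?_
    refine Real.tendsto_exp_atBot.comp ?_
    have h4 : Filter.Tendsto (fun z : ℝ × ℝ => ‖z - a‖) (Filter.cocompact _) Filter.atTop := by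
      have h5 := tendsto_norm_cocompact_atTop (E := ℝ × ℝ)
      refine Filter.tendsto_atTop_mono (fun z => ?_)
        (Filter.tendsto_atTop_add_const_right _ (-‖a‖) h5)
      linarith [norm_sub_norm_le z a]
    have h6 := (Filter.tendsto_pow_atTop (two_ne_zero)).comp h4
    have h7 := h6.const_mul_atTop_of_neg (show -Real.pi / 2 < 0 by linarith [Real.pi_pos])
    refine h7.congr fun z => ?_
    simp only [Function.comp]
    ring
  have : CompleteSpace V := hclosed.completeSpace_coe
  obtain ⟨y, hy, x, hx, hg⟩ := V.exists_add_mem_mem_orthogonal g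
  have h8 : ∀ z, inner ℂ g (coherentState z) = inner ℂ y (coherentState z) := fun z => by
    rw [hg, inner_add_left, V.inner_left_of_mem_orthogonal (hmem z) hx, add_zero]
  simp only [h8]
  exact hy

end RecentredStates

/-! ### Attainment of the maximum -/

section Maximum

theorem husimi_eq_norm_sq {ρ S : L2R →L[ℂ] L2R} (h : ∀ x y, inner ℂ x (ρ y) = inner ℂ (S x) (S y))
    (z : ℝ × ℝ) : husimi ρ z = ‖S (coherentState z)‖ ^ 2 := by
  rw [husimi, h]
  exact inner_self_eq_norm_sq (𝕜 := ℂ) _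

theorem continuous_husimi (ρ : L2R →L[ℂ] L2R) : Continuous (husimi ρ) :=
  Complex.continuous_re.comp
    (continuous_coherentState.inner (ρ.continuous.comp continuous_coherentState))

/-- The Husimi function of a density matrix attains its supremum. -/
theorem IsDensityMatrix.exists_husimi_le {ρ : L2R →L[ℂ] L2R} (hρ : IsDensityMatrix ρ) :
    ∃ z₀, ∀ z, husimi ρ z ≤ husimi ρ z₀ := by
  obtain ⟨S, hS, hSρ, ι, e, he⟩ := hρ.exists_sqrt
  by_cases h : ∃ x, 0 < husimi ρ x
  · obtain ⟨x, hx⟩ := h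
    refine (continuous_husimi ρ).exists_forall_ge' x ?_
    have := tendsto_norm_map_sq_of_tendsto_inner hS he norm_coherentState
      tendsto_inner_coherentState_cocompact
    simp only [← husimi_eq_norm_sq hSρ] at this
    exact (this.eventually_lt_const hx).mono fun _ h => h.le
  · push Not at h
    exact ⟨0, fun z => (h z).trans (by rw [husimi_eq_norm_sq hSρ]; positivity)⟩

theorem IsDensityMatrix.isGreatest_husimiMax {ρ : L2R →L[ℂ] L2R} (hρ : IsDensityMatrix ρ) :
    IsGreatest (Set.range (husimi ρ)) (husimiMax ρ) := by
  obtain ⟨z₀, hz₀⟩ := hρ.exists_husimi_le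
  have h : IsGreatest (Set.range (husimi ρ)) (husimi ρ z₀) :=
    ⟨⟨z₀, rfl⟩, by rintro _ ⟨z, rfl⟩; exact hz₀ z⟩
  rw [husimiMax, ← sSup_range, h.csSup_eq]
  exact h

end Maximum

/-! ### Expansion about a maximum point -/

section Expansion

/-- The entire function whose real part is the first order term in the expansion of
`‖S k(w)‖²`, where `k(w)` is the coherent state recentred at `z`. -/
noncomputable def firstOrderTerm (S : L2R →L[ℂ] L2R) (z : ℝ × ℝ) (w : ℂ) : ℂ :=
  2 * (inner ℂ (S (S (coherentState z))) (recentredState z w) - (‖S (coherentState z)‖ ^ 2 : ℝ))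

variable {S : L2R →L[ℂ] L2R} {z : ℝ × ℝ}

theorem differentiable_firstOrderTerm (S : L2R →L[ℂ] L2R) (z : ℝ × ℝ) :
    Differentiable ℂ (firstOrderTerm S z) :=
  ((differentiable_inner_recentredState _ z).sub_const _).const_mul 2

theorem firstOrderTerm_eq (hS : ∀ x y, inner ℂ (S x) y = inner ℂ x (S y)) (w : ℂ) :
    firstOrderTerm S z w =
      2 * inner ℂ (S (coherentState z)) (S (recentredState z w - coherentState z)) := by
  have h : ((‖S (coherentState z)‖ ^ 2 : ℝ) : ℂ) =
      inner ℂ (S (coherentState z)) (S (coherentState z)) := by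
    rw [inner_self_eq_norm_sq_to_K]; simp
  rw [firstOrderTerm, map_sub, inner_sub_right, hS (S _), h]

theorem firstOrderTerm_zero (hS : ∀ x y, inner ℂ (S x) y = inner ℂ x (S y)) :
    firstOrderTerm S z 0 = 0 := by
  rw [firstOrderTerm_eq hS, recentredState_zero]
  simp

/-- The cross term of the expanded square is the real part of an entire function because the inner
product is linear in its second argument. -/
theorem norm_map_recentredState_sq (hS : ∀ x y, inner ℂ (S x) y = inner ℂ x (S y)) (w : ℂ) :
    ‖S (recentredState z w)‖ ^ 2 = ‖S (coherentState z)‖ ^ 2 + (firstOrderTerm S z w).re +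
      ‖S (recentredState z w - coherentState z)‖ ^ 2 := by
  have h : S (recentredState z w) =
      S (coherentState z) + S (recentredState z w - coherentState z) := by
    rw [← map_add, add_sub_cancel]
  rw [h, @norm_add_sq ℂ, firstOrderTerm_eq hS]
  simp

theorem inner_coherentState_recentredState_sub (w : ℂ) :
    inner ℂ (coherentState z) (recentredState z w - coherentState z) = 0 := by
  rw [inner_sub_right, inner_coherentState_recentredState, inner_self_eq_norm_sq_to_K,
    norm_coherentState]
  simp

theorem norm_recentredState_sub_sq (w : ℂ) :
    ‖recentredState z w - coherentState z‖ ^ 2 = Real.exp (Real.pi * ‖w‖ ^ 2) - 1 := by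
  have h := norm_add_sq_eq_norm_sq_add_norm_sq_of_inner_eq_zero (𝕜 := ℂ) (coherentState z)
    (recentredState z w - coherentState z) (inner_coherentState_recentredState_sub w)
  rw [add_sub_cancel, norm_coherentState, ← pow_two, ← pow_two, norm_recentredState_sq] at h
  linarith

/-- At a maximum point of the Husimi function the first order term has a critical point. -/
theorem deriv_firstOrderTerm_zero (hS : ∀ x y, inner ℂ (S x) y = inner ℂ x (S y))
    (hmax : ∀ p, ‖S (coherentState p)‖ ^ 2 ≤ ‖S (coherentState z)‖ ^ 2) :
    deriv (firstOrderTerm S z) 0 = 0 := by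
  set T := ‖S (coherentState z)‖ ^ 2 with hT
  set F := firstOrderTerm S z with hF
  -- Maximality, after discarding the nonnegative quadratic remainder.
  have hle : ∀ w, (F w).re - T * (Real.exp (Real.pi * ‖w‖ ^ 2) - 1) ≤ 0 := fun w => by
    have h1 := hmax (z + (w.re, w.im))
    rw [norm_map_coherentState_add_sq, neg_mul, Real.exp_neg, inv_mul_le_iff₀ (Real.exp_pos _)] at h1
    simp only [Complex.eta] at h1
    rw [norm_map_recentredState_sq hS] at h1
    have := sq_nonneg ‖S (recentredState z w - coherentState z)‖
    linarith
  -- Along this direction `Re F` has slope `|F'(0)|²`, while the comparison term is flat at the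
  -- origin.
  set c := starRingEnd ℂ (deriv F 0) with hc
  have hd1 : HasDerivAt (fun t : ℝ => (F ((t : ℂ) * c)).re) (deriv F 0 * c).re 0 := by
    have hF0 : HasDerivAt F (deriv F 0) (((0 : ℝ) : ℂ) * c) := by
      simpa using ((differentiable_firstOrderTerm S z) 0).hasDerivAt
    have hlin : HasDerivAt (fun t : ℂ => t * c) c ((0 : ℝ) : ℂ) := by
      simpa using (hasDerivAt_id ((0 : ℝ) : ℂ)).mul_const c
    exact (HasDerivAt.comp ((0 : ℝ) : ℂ) hF0 hlin).real_of_complex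
  have hd2 : HasDerivAt (fun t : ℝ => T * (Real.exp (Real.pi * (t ^ 2 * ‖c‖ ^ 2)) - 1)) 0 0 := by
    have := ((((((hasDerivAt_id (0 : ℝ)).pow 2).mul_const (‖c‖ ^ 2)).const_mul Real.pi).exp).sub_const
      1).const_mul T
    simpa using this
  have hd := hd1.sub hd2
  have hloc : IsLocalMax ((fun t : ℝ => (F ((t : ℂ) * c)).re) -
      fun t : ℝ => T * (Real.exp (Real.pi * (t ^ 2 * ‖c‖ ^ 2)) - 1)) 0 := by
    refine Filter.Eventually.of_forall fun t => ?_
    have h2 := hle (t * c)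
    rw [norm_mul, mul_pow, Complex.norm_real, Real.norm_eq_abs, sq_abs] at h2
    simpa [hF, firstOrderTerm_zero hS] using h2
  have h3 := hloc.hasDerivAt_eq_zero hd
  rw [hc, Complex.mul_conj, sub_zero, Complex.ofReal_re] at h3
  exact Complex.normSq_eq_zero.1 h3

end Expansion

/-! ### Superlevel sets as perturbed discs -/

section LevelSets

variable {S : L2R →L[ℂ] L2R} {z : ℝ × ℝ} {ι : Type*} {e : HilbertBasis ι ℂ L2R}

theorem norm_map_recentredState_sub_sq_le (hS : ∀ x y, inner ℂ (S x) y = inner ℂ x (S y))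
    (he : HasSum (fun i => ‖S (e i)‖ ^ 2) 1) (w : ℂ) :
    ‖S (recentredState z w - coherentState z)‖ ^ 2 ≤
      (1 - ‖S (coherentState z)‖ ^ 2) * (Real.exp (Real.pi * ‖w‖ ^ 2) - 1) := by
  rw [← norm_recentredState_sub_sq (z := z)]
  exact norm_map_sq_le_of_inner_eq_zero hS he (norm_coherentState z)
    (inner_coherentState_recentredState_sub w)

theorem norm_map_coherentState_sq_le_one (hS : ∀ x y, inner ℂ (S x) y = inner ℂ x (S y))
    (he : HasSum (fun i => ‖S (e i)‖ ^ 2) 1) : ‖S (coherentState z)‖ ^ 2 ≤ 1 := by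
  simpa [norm_coherentState] using norm_map_sq_le_norm_sq hS he (coherentState z)

theorem norm_map_recentredState_sub_le (hS : ∀ x y, inner ℂ (S x) y = inner ℂ x (S y))
    (he : HasSum (fun i => ‖S (e i)‖ ^ 2) 1) (w : ℂ) :
    ‖S (recentredState z w - coherentState z)‖ ≤
      Real.sqrt (1 - ‖S (coherentState z)‖ ^ 2) * Real.exp (Real.pi * ‖w‖ ^ 2 / 2) := by
  have h0 : 0 ≤ 1 - ‖S (coherentState z)‖ ^ 2 :=
    sub_nonneg.2 (norm_map_coherentState_sq_le_one hS he)
  refine le_of_sq_le_sq ?_ (by positivity)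
  rw [mul_pow, Real.sq_sqrt h0, ← Real.exp_nat_mul]
  refine (norm_map_recentredState_sub_sq_le hS he w).trans (mul_le_mul_of_nonneg_left ?_ h0)
  rw [show ((2 : ℕ) : ℝ) * (Real.pi * ‖w‖ ^ 2 / 2) = Real.pi * ‖w‖ ^ 2 by push_cast; ring]
  linarith

theorem norm_map_coherentState_le_one (hS : ∀ x y, inner ℂ (S x) y = inner ℂ x (S y))
    (he : HasSum (fun i => ‖S (e i)‖ ^ 2) 1) : ‖S (coherentState z)‖ ≤ 1 :=
  le_of_sq_le_sq (by simpa using norm_map_coherentState_sq_le_one hS he) zero_le_one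

/-- Cauchy–Schwarz gives only the order `√(1 - T)`; bringing this down to `1 - T` is the role of the
mean value property. -/
theorem norm_firstOrderTerm_le (hS : ∀ x y, inner ℂ (S x) y = inner ℂ x (S y))
    (he : HasSum (fun i => ‖S (e i)‖ ^ 2) 1) (w : ℂ) :
    ‖firstOrderTerm S z w‖ ≤
      2 * (Real.sqrt (1 - ‖S (coherentState z)‖ ^ 2) * Real.exp (Real.pi * ‖w‖ ^ 2 / 2)) := by
  rw [firstOrderTerm_eq hS, norm_mul]
  have h1 := norm_inner_le_norm (𝕜 := ℂ) (S (coherentState z))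
    (S (recentredState z w - coherentState z))
  have h2 := norm_map_recentredState_sub_le (z := z) hS he w
  have h3 := mul_le_mul (norm_map_coherentState_le_one (z := z) hS he) h2 (norm_nonneg _)
    zero_le_one
  rw [one_mul] at h3
  simpa using h1.trans h3

/-- Superlevel sets of a nearly maximal Husimi function lie in a fixed disc about the maximum
point. -/
theorem exp_norm_sq_lt_of_lt_husimi (hS : ∀ x y, inner ℂ (S x) y = inner ℂ x (S y))
    (he : HasSum (fun i => ‖S (e i)‖ ^ 2) 1) {t₀ : ℝ} (ht₀ : 0 < t₀)
    (hε : Real.sqrt (1 - ‖S (coherentState z)‖ ^ 2) ≤ Real.sqrt t₀ / 2) {w : ℂ}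
    (h : t₀ * Real.exp (Real.pi * ‖w‖ ^ 2) < ‖S (recentredState z w)‖ ^ 2) :
    Real.exp (Real.pi * ‖w‖ ^ 2) < 4 / t₀ := by
  set q := Real.exp (Real.pi * ‖w‖ ^ 2 / 2) with hq
  have hq0 : 0 < q := Real.exp_pos _
  have hq2 : Real.exp (Real.pi * ‖w‖ ^ 2) = q ^ 2 := by
    rw [hq, ← Real.exp_nat_mul]; congr 1; push_cast; ring
  have h1 : ‖S (recentredState z w)‖ ≤ 1 + Real.sqrt t₀ / 2 * q := by
    have h2 : S (recentredState z w) =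
        S (coherentState z) + S (recentredState z w - coherentState z) := by
      rw [← map_add, add_sub_cancel]
    rw [h2]
    refine (norm_add_le _ _).trans (add_le_add (norm_map_coherentState_le_one hS he) ?_)
    exact (norm_map_recentredState_sub_le hS he w).trans
      (mul_le_mul_of_nonneg_right hε hq0.le)
  have h3 : (Real.sqrt t₀ * q) ^ 2 < (1 + Real.sqrt t₀ / 2 * q) ^ 2 := by
    rw [mul_pow, Real.sq_sqrt ht₀.le, ← hq2]
    exact h.trans_le (pow_le_pow_left₀ (norm_nonneg _) h1 2)
  -- Absorbing half of the left side gives `√t₀ * q < 2`, the source of `4 / t₀`.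
  have h4 := lt_of_pow_lt_pow_left₀ 2 (by positivity) h3
  have h5 : (Real.sqrt t₀ * q) ^ 2 < 2 ^ 2 := pow_lt_pow_left₀ (by linarith) (by positivity) two_ne_zero
  rw [mul_pow, Real.sq_sqrt ht₀.le] at h5
  rw [hq2, lt_div_iff₀ ht₀]
  linarith

theorem exp_sub_one_le_mul_exp (x : ℝ) : Real.exp x - 1 ≤ x * Real.exp x := by
  have h1 := Real.add_one_le_exp (-x)
  have h2 : Real.exp (-x) * Real.exp x = 1 := by rw [← Real.exp_add]; simp
  nlinarith [Real.exp_pos x]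

/-- Near the maximum point, superlevel sets of the Husimi function are contained in perturbed
discs. -/
theorem pi_mul_norm_sq_le_of_lt (hS : ∀ x y, inner ℂ (S x) y = inner ℂ x (S y))
    (he : HasSum (fun i => ‖S (e i)‖ ^ 2) 1) {b t : ℝ} (ht : 0 < t)
    (hT : 1 / 2 ≤ ‖S (coherentState z)‖ ^ 2) {w : ℂ} (hw : Real.exp (Real.pi * ‖w‖ ^ 2) ≤ b)
    (h : t * Real.exp (Real.pi * ‖w‖ ^ 2) < ‖S (recentredState z w)‖ ^ 2) :
    Real.pi * ‖w‖ ^ 2 ≤ Real.log (‖S (coherentState z)‖ ^ 2 / t) +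
      (firstOrderTerm S z w / (‖S (coherentState z)‖ ^ 2 : ℝ)).re +
      2 * Real.pi * b * (1 - ‖S (coherentState z)‖ ^ 2) * ‖w‖ ^ 2 := by
  have h1 := norm_map_recentredState_sub_sq_le (z := z) hS he w
  have hT1 : ‖S (coherentState z)‖ ^ 2 ≤ 1 := norm_map_coherentState_sq_le_one hS he
  rw [norm_map_recentredState_sq hS] at h
  rw [Complex.div_ofReal_re]
  set T := ‖S (coherentState z)‖ ^ 2
  set f := (firstOrderTerm S z w).re
  set x := Real.pi * ‖w‖ ^ 2 with hx
  have hx0 : 0 ≤ x := by positivity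
  have hT0 : 0 < T := by linarith
  have h2 : Real.exp x - 1 ≤ x * b :=
    (exp_sub_one_le_mul_exp x).trans (mul_le_mul_of_nonneg_left hw hx0)
  have h3 : t * Real.exp x < T + f + (1 - T) * (x * b) := by
    have := mul_le_mul_of_nonneg_left h2 (sub_nonneg.2 hT1)
    linarith
  have hb : 0 < b := (Real.exp_pos x).trans_le hw
  have h4 : 0 ≤ (1 - T) * (x * b) := by
    have := sub_nonneg.2 hT1
    positivity
  -- The 2 comes from dividing the remainder by `T ≥ 1/2`.
  have h5 : Real.exp x < T / t * (1 + f / T + 2 * ((1 - T) * (x * b))) := by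
    have h6 : T / t * (1 + f / T + 2 * ((1 - T) * (x * b))) =
        (T + f + 2 * T * ((1 - T) * (x * b))) / t := by
      field_simp
    rw [h6, lt_div_iff₀ ht]
    nlinarith
  have h7 : 0 < 1 + f / T + 2 * ((1 - T) * (x * b)) :=
    pos_of_mul_pos_right ((Real.exp_pos x).trans h5) (by positivity)
  have h8 := (Real.lt_log_iff_exp_lt (by positivity)).2 h5
  rw [Real.log_mul (by positivity) h7.ne'] at h8
  have h9 := Real.log_le_sub_one_of_pos h7
  have h10 : 2 * ((1 - T) * (x * b)) = 2 * Real.pi * b * (1 - T) * ‖w‖ ^ 2 := by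
    rw [hx]; ring
  linarith

/-- Area estimate for the superlevel sets of a Husimi function with a large maximum at `z`. -/
theorem volume_superlevel_le (hS : ∀ x y, inner ℂ (S x) y = inner ℂ x (S y))
    (he : HasSum (fun i => ‖S (e i)‖ ^ 2) 1)
    (hmax : ∀ p, ‖S (coherentState p)‖ ^ 2 ≤ ‖S (coherentState z)‖ ^ 2)
    {t₀ t R N A : ℝ} (ht₀ : 0 < t₀) (ht : t₀ ≤ t) (htT : t ≤ ‖S (coherentState z)‖ ^ 2)
    (hT : 1 / 2 ≤ ‖S (coherentState z)‖ ^ 2)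
    (hε : Real.sqrt (1 - ‖S (coherentState z)‖ ^ 2) ≤ Real.sqrt t₀ / 2)
    (hR : 0 ≤ R) (hRt : Real.exp (Real.pi * R ^ 2) = 4 / t₀)
    (hN : N = 4 * Real.exp (Real.pi * (R + 2) ^ 2 / 2) *
      Real.sqrt (1 - ‖S (coherentState z)‖ ^ 2))
    (hA : A = 2 * Real.pi * (4 / t₀) * (1 - ‖S (coherentState z)‖ ^ 2)) (hNA : N + A ≤ 1) :
    volume {p | t < ‖S (coherentState p)‖ ^ 2} ≤ ENNReal.ofReal
      ((1 + (2 * (N + A) ^ 2 + 2 * A)) * Real.log (‖S (coherentState z)‖ ^ 2 / t)) := by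
  have hT1 : ‖S (coherentState z)‖ ^ 2 ≤ 1 := norm_map_coherentState_sq_le_one hS he
  have ht0 : 0 < t := ht₀.trans_le ht
  have hpi := Real.pi_pos
  have hb : 0 ≤ 1 - ‖S (coherentState z)‖ ^ 2 := sub_nonneg.2 hT1
  have hcont : Continuous fun p => ‖S (coherentState p)‖ ^ 2 :=
    ((S.continuous.comp continuous_coherentState).norm).pow 2
  have htrans : volume {p | t < ‖S (coherentState p)‖ ^ 2} =
      volume {p | t < ‖S (coherentState (z + p))‖ ^ 2} :=
    (measure_preimage_add volume z {p | t < ‖S (coherentState p)‖ ^ 2}).symm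
  rw [htrans]
  set T := ‖S (coherentState z)‖ ^ 2 with hTdef
  have hT0 : 0 < T := by linarith
  have hlt : ∀ {p : ℝ × ℝ}, t < ‖S (coherentState (z + p))‖ ^ 2 →
      t * Real.exp (Real.pi * ‖(⟨p.1, p.2⟩ : ℂ)‖ ^ 2) <
        ‖S (recentredState z ⟨p.1, p.2⟩)‖ ^ 2 := fun {p} hp => by
    rw [norm_map_coherentState_add_sq, neg_mul, Real.exp_neg,
      lt_inv_mul_iff₀ (Real.exp_pos _)] at hp
    linarith
  refine volume_le_of_perturbed_disc (F := fun w => firstOrderTerm S z w / (T : ℝ)) (R := R)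
    ((differentiable_firstOrderTerm S z).div_const _)
    (by rw [firstOrderTerm_zero hS, zero_div]) ?_ ?_ (by rw [hA]; positivity) hNA hR
    (Real.log_nonneg ((one_le_div ht0).2 htT)) ?_
    (isOpen_lt continuous_const (hcont.comp (by fun_prop))).measurableSet fun p hp => ⟨?_, ?_⟩
  · rw [deriv_div_const, deriv_firstOrderTerm_zero hS hmax, zero_div]
  · intro w hw
    rw [norm_div, Complex.norm_real, Real.norm_of_nonneg hT0.le, div_le_iff₀ hT0]
    -- Dividing by `T ≥ 1/2` doubles the constant of `norm_firstOrderTerm_le`, hence the 4 in `N`.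
    have h1 : Real.exp (Real.pi * ‖w‖ ^ 2 / 2) ≤ Real.exp (Real.pi * (R + 2) ^ 2 / 2) := by
      gcongr
    have h2 := mul_le_mul_of_nonneg_left h1 (Real.sqrt_nonneg (1 - T))
    have h3 : 0 ≤ N := by rw [hN]; positivity
    have h4 := norm_firstOrderTerm_le (z := z) hS he w
    rw [← hTdef] at h4
    nlinarith
  · rw [Real.log_le_iff_le_exp (by positivity), hRt]
    gcongr
    linarith
  · have h1 := exp_norm_sq_lt_of_lt_husimi hS he ht₀ hε
      ((mul_le_mul_of_nonneg_right ht (Real.exp_pos _).le).trans_lt (hlt hp))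
    rw [← hRt, Real.exp_lt_exp] at h1
    exact le_of_sq_le_sq (le_of_mul_le_mul_left h1.le hpi) hR
  · have h1 := exp_norm_sq_lt_of_lt_husimi hS he ht₀ hε
      ((mul_le_mul_of_nonneg_right ht (Real.exp_pos _).le).trans_lt (hlt hp))
    rw [hA]
    exact pi_mul_norm_sq_le_of_lt hS he ht0 hT h1.le (hlt hp)

end LevelSets

/-! ### Choice of constants -/

theorem mainTheorem6 (t₀ : ℝ) (ht₀ : t₀ ∈ Set.Ioo (0 : ℝ) 1) :
    ∃ T₀ ∈ Set.Ioo t₀ 1, ∃ C₀ : ℝ, 0 < C₀ ∧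
      ∀ ρ : L2R →L[ℂ] L2R, IsDensityMatrix ρ →
        IsGreatest (Set.range (husimi ρ)) (husimiMax ρ) ∧
        (T₀ ≤ husimiMax ρ →
          ∀ t ∈ Set.Icc t₀ (husimiMax ρ),
            husimiDistr ρ t ≤
              ENNReal.ofReal ((1 + C₀ * (1 - husimiMax ρ)) * Real.log (husimiMax ρ / t))) := by
  obtain ⟨h0, h1⟩ := ht₀
  have hpi := Real.pi_pos
  have hlog : 0 ≤ Real.log (4 / t₀) := Real.log_nonneg (by rw [le_div_iff₀ h0]; linarith)
  set R := Real.sqrt (Real.log (4 / t₀) / Real.pi) with hR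
  have hRt : Real.exp (Real.pi * R ^ 2) = 4 / t₀ := by
    rw [hR, Real.sq_sqrt (by positivity), mul_div_cancel₀ _ hpi.ne', Real.exp_log (by positivity)]
  set N₀ := 4 * Real.exp (Real.pi * (R + 2) ^ 2 / 2) with hN₀
  set A₀ := 2 * Real.pi * (4 / t₀) with hA₀
  have hN₀pos : 0 < N₀ := by positivity
  have hA₀pos : 0 < A₀ := by positivity
  -- For `√(1 - T) ≤ η`, the three entries give `1 - T ≤ √(1 - T)`, the smallness `N + A ≤ 1`, and
  -- the confinement to the disc of radius `R`.
  set η := min (min 1 (1 / (N₀ + A₀))) (Real.sqrt t₀ / 2) with hη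
  have hηpos : 0 < η := lt_min (lt_min one_pos (by positivity)) (by positivity)
  -- The second entry secures both `T₀ > t₀` and `T ≥ 1/2`. The value of `C₀` comes from `N + A ≤
  -- (N₀ + A₀)√(1 - T)`, whose square is linear in `1 - T`.
  refine ⟨max (1 - η ^ 2) ((1 + t₀) / 2), ⟨lt_max_of_lt_right (by linarith),
    max_lt (by linarith [pow_pos hηpos 2]) (by linarith)⟩, 2 * (N₀ + A₀) ^ 2 + 2 * A₀,
    by positivity, fun ρ hρ => ⟨hρ.isGreatest_husimiMax, fun hT t ht => ?_⟩⟩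
  obtain ⟨⟨z, hz⟩, hmax⟩ := hρ.isGreatest_husimiMax
  obtain ⟨S, hS, hSρ, ι, e, he⟩ := hρ.exists_sqrt
  have hus := husimi_eq_norm_sq hSρ
  have hmax' : ∀ p, ‖S (coherentState p)‖ ^ 2 ≤ ‖S (coherentState z)‖ ^ 2 := fun p => by
    rw [← hus, ← hus, hz]
    exact hmax ⟨p, rfl⟩
  have hTeq : husimiMax ρ = ‖S (coherentState z)‖ ^ 2 := by rw [← hz, hus]
  have hT1 := norm_map_coherentState_sq_le_one (z := z) hS he
  rw [husimiDistr]
  simp only [hus]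
  rw [hTeq] at hT ht ⊢
  set T := ‖S (coherentState z)‖ ^ 2 with hTdef
  have hεη : Real.sqrt (1 - T) ≤ η :=
    Real.sqrt_le_iff.2 ⟨hηpos.le, by linarith [(le_max_left _ _).trans hT]⟩
  have hε1 : Real.sqrt (1 - T) ≤ 1 := hεη.trans ((min_le_left _ _).trans (min_le_left _ _))
  have hε2 : Real.sqrt (1 - T) ≤ 1 / (N₀ + A₀) :=
    hεη.trans ((min_le_left _ _).trans (min_le_right _ _))
  have hεsq : Real.sqrt (1 - T) ^ 2 = 1 - T := Real.sq_sqrt (by linarith)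
  have hε0 := Real.sqrt_nonneg (1 - T)
  have hsum : N₀ * Real.sqrt (1 - T) + A₀ * (1 - T) ≤ (N₀ + A₀) * Real.sqrt (1 - T) := by
    have : 1 - T ≤ Real.sqrt (1 - T) := by nlinarith
    nlinarith
  have hvol := volume_superlevel_le hS he hmax' h0 ht.1 ht.2
    (by linarith [(le_max_right _ _).trans hT]) (hεη.trans (min_le_right _ _))
    (Real.sqrt_nonneg _) hRt rfl rfl (hsum.trans (by
      rw [le_div_iff₀ (by positivity)] at hε2
      linarith))
  refine hvol.trans (ENNReal.ofReal_le_ofReal (mul_le_mul_of_nonneg_right ?_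
    (Real.log_nonneg ((one_le_div (h0.trans_le ht.1)).2 ht.2))))
  have hpos : 0 ≤ N₀ * Real.sqrt (1 - T) + A₀ * (1 - T) := by
    have : 0 ≤ 1 - T := by linarith
    positivity
  have hsq := pow_le_pow_left₀ hpos hsum 2
  rw [mul_pow, hεsq] at hsq
  linarith
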